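/- Let $G$ be a torsion-free abelian group, written multiplicatively, and let $\ell, m$ be integers with $2 \le \ell < m$. Let $\mathcal{A} = (A_1,\dots,A_m)$ be a sequence of finite subsets of $G$ with $|A_i| \ge 2$ for all $i$, and put $A = A_1\cup\dots\cup A_m$. Let $$\Pi^{\ell}(\mathcal{A}) = \{a_{1}\cdots a_{\ell} : a_{j}\in A_{i_j} \text{ for some pairwise distinct } i_1,\dots,i_\ell\in\{1,\dots,m\}\},$$ let $\mu(a) = \min\bigl(\ell,\ |\{i : a\in A_i\}|\bigr)$ for $a\in A$, and let $M=\{a\in A : \mu(a)=\ell\}$. A nonempty finite set $S\subseteq G$ is a *geometric progression with common ratio* $g\neq 1$ if $S=\{a,ag,\dots,ag^{|S|-1}\}$ for some $a\in G$, and it is a *geometric progression of type* $(a,g,b)$, where $g \neq 1$, if $S=\{ab,agb,\dots,ag^{|S|-1}b\}$. For $d\in G$, $d \ne 1$, the sequence $\mathcal{A}$ is called *$(\ell,d)$-minimizing* if there are sets $B_1,\dots,B_\ell\subseteq A$ such that 1. $|B_i|\ge 2$ for all $i$; 2. there are $\alpha_i,\beta_i\in G$ such that each $B_i$ is a geometric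 progression of type $(\alpha_i,d,\beta_i)$ and $\alpha_{i+1}=\beta_i^{-1}$ for $1\le i\le \ell-1$; 3. $\mu(a)=|\{j : a\in B_j\}|$ for every $a\in A$; 4. $B_1\cdots B_\ell=\Pi^\ell(\mathcal{A})$. Then $$|\Pi^{\ell}(\mathcal{A})| = \sum_{a\in A}\mu(a)-\ell+1 \qquad (*)$$ holds if and only if $\mathcal{A}$ is $(\ell,d)$-minimizing for some $d\in G$. Moreover, if $(*)$ holds, then there is a single $g\in G$ with $g\neq 1$ such that each of the sets $A_1\cup M,\dots,A_m\cup M$ is a geometric progression with common ratio $g$, and $A$ is also a geometric progression with common ratio $g$. -/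

import Mathlib

namespace GenProductSet

/-- The union `A = A₁ ∪ ⋯ ∪ A_m` of a finite sequence of finite sets. -/
def unionSet {G : Type*} [DecidableEq G] {m : ℕ} (A : Fin m → Finset G) : Finset G :=
  Finset.univ.biUnion A

/-- The product set `B₁ ⋯ B_ℓ`: all products `b₁ ⋯ b_ℓ`, in this order, with `b_j ∈ B_j`. -/
def orderedProd {G : Type*} [Group G] {l : ℕ} (B : Fin l → Finset G) : Set G :=
  {x | ∃ b : Fin l → G, (∀ j, b j ∈ B j) ∧ (List.ofFn b).prod = x}

/-- The generalized product set `Π^ℓ(A₁, …, A_m)`: all products `a_{i₁} ⋯ a_{i_ℓ}` of exactly `ℓ`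
elements chosen from `ℓ` distinct sets of the sequence, taken in any order. -/
def genProd {G : Type*} [Group G] {m : ℕ} (l : ℕ) (A : Fin m → Finset G) : Set G :=
  {x | ∃ i : Fin l → Fin m, Function.Injective i ∧
    ∃ a : Fin l → G, (∀ j, a j ∈ A (i j)) ∧ (List.ofFn a).prod = x}

/-- `μ(a) = min (ℓ, ∑_j χ_{A_j}(a))`. -/
def mu {G : Type*} [DecidableEq G] {m : ℕ} (l : ℕ) (A : Fin m → Finset G) (a : G) : ℕ :=
  min l (∑ j, if a ∈ A j then 1 else 0)

/-- The set `M = {a ∈ A : μ(a) = ℓ}`. -/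
def fullSet {G : Type*} [DecidableEq G] {m : ℕ} (l : ℕ) (A : Fin m → Finset G) : Finset G :=
  (unionSet A).filter (fun a => mu l A a = l)

/-- `S` is a geometric progression with common ratio `g ≠ 1`:
`S = {a, a g, …, a g ^ (|S| - 1)}` for some `a`, and `S` is nonempty. -/
def IsGeomProg {G : Type*} [Group G] [DecidableEq G] (S : Finset G) (g : G) : Prop :=
  S.Nonempty ∧ g ≠ 1 ∧ ∃ a : G, S = (Finset.range S.card).image (fun k => a * g ^ k)

/-- `S` is a geometric progression of type `(a, g, b)`, with `g ≠ 1`: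
`S = {a b, a g b, …, a g ^ (|S| - 1) b}`, and `S` is nonempty. -/
def IsGeomProgOfType {G : Type*} [Group G] [DecidableEq G] (S : Finset G) (a g b : G) : Prop :=
  S.Nonempty ∧ g ≠ 1 ∧ S = (Finset.range S.card).image (fun k => a * g ^ k * b)

/-- `A₁, …, A_m` is an `(ℓ, g)`-minimizing sequence of sets. -/
def IsMinimizing {G : Type*} [Group G] [DecidableEq G] {m : ℕ} (l : ℕ) (g : G)
    (A : Fin m → Finset G) : Prop :=
  g ≠ 1 ∧ ∃ B : Fin l → Finset G,
    (∀ i, B i ⊆ unionSet A) ∧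
    (∀ i, 2 ≤ (B i).card) ∧
    (∃ α β : Fin l → G, (∀ i, IsGeomProgOfType (B i) (α i) g (β i)) ∧
      ∀ i j : Fin l, (j : ℕ) = i + 1 → α j = (β i)⁻¹) ∧
    (∀ a ∈ unionSet A, mu l A a = ∑ j, if a ∈ B j then 1 else 0) ∧
    orderedProd B = genProd l A

end GenProductSet

/-!
The lower bound for the generalized product set, and its equality case, follow from an uncrossing
argument. Replacing two sets `A k`, `A j` of the sequence by `A k ∪ A j` and `A j ∩ A k` keeps the
multiplicity of every element and can only shrink the set of products (`selProd_uncross_subset`).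
Uncrossing one index `j` with all the others leaves at `j` the intersection of all the sets. While
there are more than `l` sets, this intersection can be discarded without affecting the
multiplicities truncated at `l` (`exists_remove`). Hence for any `l` of the indices there are sets
`B i ⊇ A i` covering every `a` exactly `μ(a)` times and with `∏ B i ⊆ Π^l(A)`
(`exists_isReduction`).

A torsion-free commutative group can be linearly ordered. Iterating the Cauchy–Davenport bound gives
`|∏ B i| ≥ ∑ |B i| - l + 1 = ∑ μ(a) - l + 1`, so equality for `Π^l(A)` means `∏ B i = Π^l(A)` and
equality in the bound. As all `B i` have at least two elements, they are then progressions with a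
common ratio `d > 1` (`exists_ratio_of_card_prod`), and `d` is the ratio of the two smallest
elements of `Π^l(A)`, hence the same for all choices made in the reduction. This freedom gives the
structure of the sequence: one reduction has `B i = A i ∪ M` at a prescribed index
(`isStepClosed_union_filter`), and any two of the sets `A k`, `A j` lie together in a single `B k`
of another, so the union of the sequence is a progression too (`isStepClosed_biUnion`).

Conversely, a product of progressions with a common ratio attains the bound
(`ncard_eq_of_isMinimizing`).
-/

open Finset
open scoped Pointwise

namespace GenProductSet

/-! ### Ordering a torsion-free commutative group -/

/-- The group embeds in its divisible hull, a `ℚ`-vector space; a basis indexed by a well-ordered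
set identifies that space with finitely supported functions, which are ordered lexicographically. -/
theorem exists_linearOrder_isOrderedMonoid (G : Type*) [CommGroup G] [IsMulTorsionFree G] :
    ∃ _ : LinearOrder G, IsOrderedMonoid G := by
  classical
  let b := Module.Basis.ofVectorSpace ℚ (DivisibleHull (Additive G))
  let _ : LinearOrder (Module.Basis.ofVectorSpaceIndex ℚ (DivisibleHull (Additive G))) :=
    IsWellOrder.linearOrder WellOrderingRel
  let f : G → Lex (Module.Basis.ofVectorSpaceIndex ℚ (DivisibleHull (Additive G)) →₀ ℚ) :=
    fun g => toLex (b.repr (DivisibleHull.coe (Additive.ofMul g)))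
  have hf : Function.Injective f := fun x y h =>
    Additive.ofMul.injective <| DivisibleHull.coe_injective <| b.repr.injective <| toLex.injective h
  have hmul : ∀ x y, f (x * y) = f x + f y := fun x y => by
    simp only [f, ofMul_mul, DivisibleHull.coe_add, map_add, toLex_add]
  let _ : LinearOrder G := LinearOrder.lift' f hf
  refine ⟨inferInstance, ⟨fun x y h z => ?_, fun x y h z => ?_⟩⟩
  all_goals
    change f _ ≤ f _ at h
    change f _ ≤ f _
    rw [hmul, hmul]
    gcongr

/-! ### Selections from distinct sets and uncrossing -/

section Selections

variable {ι G : Type*} [DecidableEq G]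

/-- The number of indices `i ∈ s` with `a ∈ A i`. -/
def deg (s : Finset ι) (A : ι → Finset G) (a : G) : ℕ := #{i ∈ s | a ∈ A i}

section Uncross

variable [DecidableEq ι]

/-- Replace the sets `A k` and `A j` by their union (at `k`) and their intersection (at `j`). -/
def uncross (A : ι → Finset G) (k j : ι) : ι → Finset G :=
  Function.update (Function.update A k (A k ∪ A j)) j (A j ∩ A k)

theorem uncross_left {A : ι → Finset G} {k j : ι} (h : k ≠ j) :
    uncross A k j k = A k ∪ A j := by simp [uncross, h]

theorem uncross_right {A : ι → Finset G} {k j : ι} : uncross A k j j = A j ∩ A k := by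
  simp [uncross]

theorem uncross_of_ne {A : ι → Finset G} {k j i : ι} (hk : i ≠ k) (hj : i ≠ j) :
    uncross A k j i = A i := by simp [uncross, hk, hj]

theorem subset_uncross {A : ι → Finset G} {k j i : ι} (hj : i ≠ j) : A i ⊆ uncross A k j i := by
  by_cases hk : i = k
  · subst hk; rw [uncross_left hj]; exact subset_union_left
  · rw [uncross_of_ne hk hj]

theorem deg_uncross {A : ι → Finset G} {s : Finset ι} {k j : ι} (hk : k ∈ s) (hj : j ∈ s)
    (h : k ≠ j) (a : G) : deg s (uncross A k j) a = deg s A a := by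
  have hj' : j ∈ s.erase k := mem_erase.2 ⟨h.symm, hj⟩
  simp only [deg, card_filter]
  rw [← add_sum_erase s _ hk, ← add_sum_erase s _ hk, ← add_sum_erase _ _ hj',
    ← add_sum_erase _ _ hj', ← add_assoc, ← add_assoc]
  congr 1
  · rw [uncross_left h, uncross_right]
    by_cases h1 : a ∈ A k <;> by_cases h2 : a ∈ A j <;> simp [h1, h2]
  · refine sum_congr rfl fun i hi => ?_
    simp only [mem_erase] at hi
    rw [uncross_of_ne hi.2.1 hi.1]

end Uncross

variable [CommGroup G]

/-- The products of elements chosen from exactly `l` distinct sets of the family `(A i)_{i ∈ s}`,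
as the union over the `l`-element sets of indices `T ⊆ s` of the product sets `∏ i ∈ T, A i`. -/
def selProd (l : ℕ) (s : Finset ι) (A : ι → Finset G) : Finset G :=
  (s.powersetCard l).biUnion fun T => ∏ i ∈ T, A i

theorem mem_selProd {l : ℕ} {s : Finset ι} {A : ι → Finset G} {x : G} :
    x ∈ selProd l s A ↔ ∃ T ⊆ s, #T = l ∧ ∃ f : ι → G, (∀ i ∈ T, f i ∈ A i) ∧ ∏ i ∈ T, f i = x := by
  simp only [selProd, mem_biUnion, mem_powersetCard, and_assoc]
  refine exists_congr fun T => and_congr_right fun _ => and_congr_right fun _ => ?_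
  rw [← mem_coe, coe_prod, Set.mem_finsetProd]
  simp only [mem_coe]
  exact ⟨fun ⟨f, h, e⟩ => ⟨f, fun i hi => h hi, e⟩, fun ⟨f, h, e⟩ => ⟨f, fun {i} hi => h i hi, e⟩⟩

/-- The family `(A i)_{i ∈ s}` reduces to `(B i)_{i ∈ s₀}`: for `i ∈ s₀` the set `B i` contains
`A i`, the `B i` cover every `a` with its multiplicity truncated at `l`, and the product set
of the `B i` consists of products of `l` elements from distinct sets of `(A i)_{i ∈ s}`. It is
used with `#s₀ = l`. -/
structure IsReduction (l : ℕ) (s : Finset ι) (A : ι → Finset G) (s₀ : Finset ι)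
    (B : ι → Finset G) : Prop where
  subset : ∀ i ∈ s₀, A i ⊆ B i
  deg_eq : ∀ a, deg s₀ B a = min l (deg s A a)
  prod_subset : ∏ i ∈ s₀, B i ⊆ selProd l s A

theorem IsReduction.mem_iff {l : ℕ} {s s₀ : Finset ι} {A B : ι → Finset G}
    (h : IsReduction l s A s₀ B) (hl : 0 < l) (a : G) :
    (∃ i ∈ s₀, a ∈ B i) ↔ ∃ i ∈ s, a ∈ A i := by
  have key : ∀ (t : Finset ι) (C : ι → Finset G), (∃ i ∈ t, a ∈ C i) ↔ 0 < deg t C a := by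
    intro t C
    simp [deg, card_pos, Finset.Nonempty]
  rw [key, key, h.deg_eq]
  omega

theorem IsReduction.sum_card {l : ℕ} {s s₀ : Finset ι} {A B : ι → Finset G}
    (h : IsReduction l s A s₀ B) (hl : 0 < l) :
    ∑ i ∈ s₀, #(B i) = ∑ a ∈ s.biUnion A, min l (deg s A a) := by
  have : ∀ i ∈ s₀, #(B i) = ∑ a ∈ s.biUnion A, if a ∈ B i then 1 else 0 := by
    intro i hi
    rw [← card_filter, filter_mem_eq_inter, inter_eq_right.2]
    intro a ha
    simpa using (h.mem_iff hl a).1 ⟨i, hi, ha⟩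
  rw [sum_congr rfl this, sum_comm]
  refine sum_congr rfl fun a _ => ?_
  rw [← h.deg_eq, deg, card_filter]

variable [DecidableEq ι]

/-- A choice from the uncrossed family is a choice from the original one: an element taken at `j`
lies in both `A k` and `A j`, so it can trade places with an element of `A j` taken at `k`. -/
theorem selProd_uncross_subset {A : ι → Finset G} {s : Finset ι} {k j : ι} (l : ℕ) (hk : k ∈ s)
    (hj : j ∈ s) (h : k ≠ j) : selProd l s (uncross A k j) ⊆ selProd l s A := by
  intro x hx
  obtain ⟨T, hTs, hT, f, hf, rfl⟩ := mem_selProd.1 hx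
  refine mem_selProd.2 ?_
  by_cases hfk : k ∈ T → f k ∈ A k
  · refine ⟨T, hTs, hT, f, fun i hi => ?_, rfl⟩
    by_cases hik : i = k
    · subst hik; exact hfk hi
    have := hf i hi
    by_cases hij : i = j
    · subst hij; rw [uncross_right] at this; exact (mem_inter.1 this).1
    · rwa [uncross_of_ne hik hij] at this
  · -- Otherwise `f k ∈ A j`: apply the transposition of `j` and `k` to the whole choice.
    push Not at hfk
    obtain ⟨hkT, hfk⟩ := hfk
    have hfj : f k ∈ A j := by
      have := hf k hkT
      rw [uncross_left h, mem_union] at this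
      exact this.resolve_left hfk
    refine ⟨T.map (Equiv.swap k j).toEmbedding, ?_, by simpa, fun i => f (Equiv.swap k j i), ?_, ?_⟩
    · intro i hi
      obtain ⟨i, hiT, rfl⟩ := mem_map.1 hi
      simp only [Equiv.toEmbedding_apply, Equiv.swap_apply_def]
      split_ifs
      exacts [hj, hk, hTs hiT]
    · intro i hi
      obtain ⟨i, hiT, rfl⟩ := mem_map.1 hi
      have := hf i hiT
      simp only [Equiv.toEmbedding_apply, Equiv.swap_apply_self]
      rcases eq_or_ne i k with rfl | hik
      · simpa using hfj
      rcases eq_or_ne i j with rfl | hij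
      · rw [uncross_right] at this
        simpa using (mem_inter.1 this).2
      · rwa [Equiv.swap_apply_of_ne_of_ne hik hij, ← uncross_of_ne (A := A) hik hij]
    · simp

/-- Uncrossing `j` with each index of `t` in turn leaves at `j` only the elements common to `A j`
and all `A k`, `k ∈ t`, and enlarges the other sets. -/
theorem exists_absorb {s : Finset ι} {j : ι} (l : ℕ) (A : ι → Finset G) (hj : j ∈ s)
    {t : Finset ι} (ht : t ⊆ s.erase j) :
    ∃ A' : ι → Finset G, (∀ i ≠ j, A i ⊆ A' i) ∧ (∀ a, a ∈ A' j ↔ a ∈ A j ∧ ∀ k ∈ t, a ∈ A k) ∧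
      (∀ i ∉ t, i ≠ j → A' i = A i) ∧ (∀ a, deg s A' a = deg s A a) ∧
      selProd l s A' ⊆ selProd l s A := by
  induction t using Finset.induction_on with
  | empty => exact ⟨A, by simp⟩
  | insert k t hkt ih =>
    rw [insert_subset_iff, mem_erase] at ht
    obtain ⟨A', h1, h2, h3, h4, h5⟩ := ih ht.2
    obtain ⟨⟨hkj, hks⟩, ht⟩ := ht
    refine ⟨uncross A' k j, fun i hi => (h1 i hi).trans (subset_uncross hi), fun a => ?_,
      fun i hi hij => ?_, fun a => (deg_uncross hks hj hkj a).trans (h4 a),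
      (selProd_uncross_subset l hks hj hkj).trans h5⟩
    · rw [uncross_right, mem_inter, h2, h3 k hkt hkj]
      simp only [mem_insert, forall_eq_or_imp]
      tauto
    · rw [mem_insert, not_or] at hi
      rw [uncross_of_ne hi.1 hij, h3 i hi.2 hij]

/-- One index `j` can be removed when there are more than `l` sets: once `j` has been uncrossed with
all other indices, the elements left at `j` lie in every set, so dropping that set does not change
the multiplicities truncated at `l`. The index `i₀` is uncrossed last, so that `A i₀` only gains
elements that already lie in all the other sets. -/
theorem exists_remove {s : Finset ι} {j i₀ : ι} {l : ℕ} (A : ι → Finset G) (hj : j ∈ s)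
    (hi₀ : i₀ ∈ s) (hne : i₀ ≠ j) (hl : l < #s) :
    ∃ A' : ι → Finset G, (∀ i ∈ s.erase j, A i ⊆ A' i) ∧
      (∀ a, min l (deg (s.erase j) A' a) = min l (deg s A a)) ∧
      selProd l (s.erase j) A' ⊆ selProd l s A ∧
      (∀ a ∈ A' i₀, a ∉ A i₀ → l ≤ deg s A a) := by
  obtain ⟨A', h1, h2, h3, h4, h5⟩ :=
    exists_absorb l A hj (erase_subset i₀ (s.erase j))
  have hi : A' i₀ = A i₀ := h3 i₀ (by simp) hne
  have hmono : ∀ i ≠ j, A i ⊆ uncross A' i₀ j i := fun i hij =>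
    (h1 i hij).trans (subset_uncross hij)
  refine ⟨uncross A' i₀ j, fun i hi => hmono i (ne_of_mem_erase hi), fun a => ?_, ?_, ?_⟩
  · rw [← h4 a, ← deg_uncross hi₀ hj hne a]
    -- An element left at `j` lies in all `#s` sets, and `#s - 1 ≥ l` of them remain.
    by_cases ha : a ∈ uncross A' i₀ j j
    · have hall : ∀ i ∈ s, a ∈ uncross A' i₀ j i := by
        intro i his
        by_cases hij : i = j
        · rwa [hij]
        refine hmono i hij ?_
        rw [uncross_right, mem_inter, h2, hi] at ha
        by_cases hii : i = i₀
        · rw [hii]; exact ha.2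
        · exact ha.1.2 i (by simp [hii, hij, his])
      have e1 : deg s (uncross A' i₀ j) a = #s := by
        rw [deg, filter_true_of_mem hall]
      have e2 : deg (s.erase j) (uncross A' i₀ j) a = #s - 1 := by
        rw [deg, filter_true_of_mem fun i hi => hall i (mem_of_mem_erase hi), card_erase_of_mem hj]
      omega
    · congr 1
      rw [deg, deg, filter_erase, erase_eq_of_notMem]
      simp [ha]
  · refine Subset.trans ?_ ((selProd_uncross_subset l hi₀ hj hne).trans h5)
    exact biUnion_subset_biUnion_of_subset_left _ (powersetCard_mono (erase_subset _ _))
  · intro a ha hna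
    rw [uncross_left hne, mem_union, hi, h2] at ha
    have ha := ha.resolve_left hna
    have : s.erase i₀ ⊆ {i ∈ s | a ∈ A i} := by
      intro i his
      obtain ⟨hii, his⟩ := mem_erase.1 his
      refine mem_filter.2 ⟨his, ?_⟩
      by_cases hij : i = j
      · rw [hij]; exact ha.1
      · exact ha.2 i (by simp [hii, hij, his])
    have := card_le_card this
    rw [card_erase_of_mem hi₀] at this
    rw [deg]
    omega

/-- Any `#s₀` of the sets carry a reduction, obtained by removing the other indices one at a time.
At a prescribed index `i₀` only elements of multiplicity at least `#s₀` are gained. -/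
theorem exists_isReduction {s₀ : Finset ι} {i₀ : ι} (hi₀ : i₀ ∈ s₀) {s : Finset ι}
    (hs : s₀ ⊆ s) (A : ι → Finset G) :
    ∃ B, IsReduction #s₀ s A s₀ B ∧ ∀ a ∈ B i₀, a ∉ A i₀ → #s₀ ≤ deg s A a := by
  induction hn : #s generalizing s A with
  | zero =>
    have := card_pos.2 ⟨i₀, hi₀⟩
    have := card_le_card hs
    omega
  | succ n ih =>
    by_cases hss : s₀ = s
    · refine ⟨A, ⟨fun i _ => Subset.rfl, fun a => ?_, ?_⟩, fun a h h' => absurd h h'⟩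
      · rw [hss, min_eq_right]
        exact card_filter_le _ _
      · rw [hss]
        simp [selProd]
    · obtain ⟨j, hjs, hj⟩ := exists_of_ssubset (hs.ssubset_of_ne hss)
      have hne : i₀ ≠ j := fun h => hj (h ▸ hi₀)
      have hlt : #s₀ < #s := card_lt_card (hs.ssubset_of_ne hss)
      obtain ⟨A', h1, h2, h3, h4⟩ := exists_remove A hjs (hs hi₀) hne hlt
      have hs' : s₀ ⊆ s.erase j := subset_erase.2 ⟨hs, hj⟩
      obtain ⟨B, hB, hB'⟩ := ih hs' A' (by rw [card_erase_of_mem hjs]; omega)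
      refine ⟨B, ⟨fun i hi => (h1 i (hs' hi)).trans (hB.subset i hi),
        fun a => (hB.deg_eq a).trans (h2 a), hB.prod_subset.trans h3⟩, fun a ha hna => ?_⟩
      by_cases ha' : a ∈ A' i₀
      · exact h4 a ha' hna
      · have := hB' a ha ha'
        have := h2 a
        omega

/-- A reduction in which the set at `k` contains `A j` as well, for a removed index `j`: uncross `k`
and `j` before reducing. -/
theorem exists_isReduction_union {s₀ s : Finset ι} {k j : ι} (hs : s₀ ⊆ s) (hk : k ∈ s₀)
    (hjs : j ∈ s) (hj : j ∉ s₀) (A : ι → Finset G) :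
    ∃ B, IsReduction #s₀ s A s₀ B ∧ A k ∪ A j ⊆ B k := by
  have hne : k ≠ j := fun h => hj (h ▸ hk)
  obtain ⟨B, hB, -⟩ := exists_isReduction hk hs (uncross A k j)
  refine ⟨B, ⟨fun i hi => (subset_uncross (ne_of_mem_of_not_mem hi hj)).trans (hB.subset i hi),
    fun a => by rw [hB.deg_eq, deg_uncross (hs hk) hjs hne],
    hB.prod_subset.trans (selProd_uncross_subset _ (hs hk) hjs hne)⟩, ?_⟩
  rw [← uncross_left hne]
  exact hB.subset k hk

end Selections

/-! ### Two-factor products of minimal size in an ordered group -/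

section Order

variable {G : Type*} [CommGroup G] [LinearOrder G]

/-- Each element `s` of `S` other than the greatest has successor `s * d` in `S`. For nonempty `S` and
`1 < d` this says that `S` is a geometric progression with ratio `d`, without naming its first
element or its length. -/
def IsStepClosed (S : Finset G) (d : G) : Prop := ∀ s ∈ S, ∀ t ∈ S, s < t → s * d ∈ S ∧ s * d ≤ t

/-- The two smallest elements of `P` are `a` and `a * d` for some `a`, where `1 < d`. -/
def IsFirstStep (P : Finset G) (d : G) : Prop :=
  1 < d ∧ ∃ a ∈ P, a * d ∈ P ∧ ∀ x ∈ P, x = a ∨ a * d ≤ x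

variable [IsOrderedMonoid G]

theorem IsFirstStep.unique {P : Finset G} {d e : G} (hd : IsFirstStep P d) (he : IsFirstStep P e) :
    d = e := by
  obtain ⟨hd1, a, ha, had, hmin⟩ := hd
  obtain ⟨he1, b, hb, hbe, hmin'⟩ := he
  have h1 := lt_mul_of_one_lt_right' a hd1
  have h2 := lt_mul_of_one_lt_right' b he1
  have hab : a = b := by
    rcases hmin b hb with h | h
    · exact h.symm
    rcases hmin' a ha with h' | h'
    · exact h'
    · exact absurd (h1.trans_le h) (h2.trans_le h').not_gt
  subst hab
  have h3 := (hmin _ hbe).resolve_left h2.ne'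
  have h4 := (hmin' _ had).resolve_left h1.ne'
  exact mul_left_cancel (h3.antisymm h4)

theorem IsStepClosed.isGeomProg {S : Finset G} {d : G} (hS : S.Nonempty) (hd : 1 < d)
    (h : IsStepClosed S d) : IsGeomProg S d := by
  refine ⟨hS, hd.ne', ?_⟩
  induction S using Finset.induction_on_max with
  | empty => simp at hS
  | insert b S hb ih =>
    have hbS : b ∉ S := fun h => (hb b h).false
    rcases S.eq_empty_or_nonempty with rfl | hS'
    · exact ⟨b, by simp⟩
    have key : ∀ s ∈ S, s * d ≠ b → s * d ∈ S := fun s hs hne =>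
      mem_of_mem_insert_of_ne (h s (mem_insert_of_mem hs) b (mem_insert_self _ _) (hb s hs)).1 hne
    obtain ⟨a, ha⟩ := ih hS' fun s hs t ht hst => by
      obtain ⟨h1, h2⟩ := h s (mem_insert_of_mem hs) t (mem_insert_of_mem ht) hst
      exact ⟨key s hs (h2.trans_lt (hb t ht)).ne, h2⟩
    obtain ⟨n, hn⟩ : ∃ n, #S = n + 1 := ⟨#S - 1, by have := hS'.card_pos; omega⟩
    have hlast : a * d ^ n ∈ S := by
      rw [ha]; exact mem_image_of_mem _ (by simp [hn])
    have hnext : a * d ^ (n + 1) = b := by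
      by_contra hne
      have := key _ hlast (by rwa [mul_assoc, ← pow_succ])
      rw [mul_assoc, ← pow_succ, ha, mem_image, hn] at this
      obtain ⟨k, hk, e⟩ := this
      have := (pow_right_strictMono' hd).injective (mul_left_cancel e)
      simp at hk
      omega
    refine ⟨a, ?_⟩
    rw [card_insert_of_notMem hbS, range_add_one, image_insert, ← ha, hn, hnext]

/-- If `S * R` has the least possible size, then the rank of `s * r` in `S * R` is determined by the
ranks of `s` and `r`: the Cauchy–Davenport bound for the elements up to `s` and `r`, together with
the one for the elements from `s` and `r` on, already accounts for all of `S * R`. -/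
theorem card_filter_le_mul {S R : Finset G} (h : #(S * R) + 1 = #S + #R) {s r : G} (hs : s ∈ S)
    (hr : r ∈ R) : #{x ∈ S * R | x ≤ s * r} + 1 = #{x ∈ S | x ≤ s} + #{x ∈ R | x ≤ r} := by
  have nS : ({x ∈ S | x ≤ s}).Nonempty := ⟨s, by simp [hs]⟩
  have nR : ({x ∈ R | x ≤ r}).Nonempty := ⟨r, by simp [hr]⟩
  have nS' : ({x ∈ S | s ≤ x}).Nonempty := ⟨s, by simp [hs]⟩
  have nR' : ({x ∈ R | r ≤ x}).Nonempty := ⟨r, by simp [hr]⟩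
  have h1 := cauchy_davenport_mul_of_linearOrder_isCancelMul nS nR
  have h2 := cauchy_davenport_mul_of_linearOrder_isCancelMul nS' nR'
  have l1 : {x ∈ S | x ≤ s} * {x ∈ R | x ≤ r} ⊆ {x ∈ S * R | x ≤ s * r} := by
    intro x hx
    obtain ⟨y, hy, z, hz, rfl⟩ := mem_mul.1 hx
    simp only [mem_filter] at hy hz ⊢
    exact ⟨mul_mem_mul hy.1 hz.1, mul_le_mul' hy.2 hz.2⟩
  have l2 : {x ∈ S | s ≤ x} * {x ∈ R | r ≤ x} ⊆ {x ∈ S * R | s * r ≤ x} := by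
    intro x hx
    obtain ⟨y, hy, z, hz, rfl⟩ := mem_mul.1 hx
    simp only [mem_filter] at hy hz ⊢
    exact ⟨mul_mem_mul hy.1 hz.1, mul_le_mul' hy.2 hz.2⟩
  have l1 := card_le_card l1
  have l2 := card_le_card l2
  have split : ∀ (T : Finset G) (x : G), x ∈ T → #{y ∈ T | y ≤ x} + #{y ∈ T | x ≤ y} = #T + 1 := by
    intro T x hx
    rw [← card_union_add_card_inter, ← filter_or, ← filter_and,
      filter_true_of_mem fun y _ => le_total y x]
    congr 1
    rw [card_eq_one]
    refine ⟨x, ?_⟩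
    ext y
    simp only [mem_filter, mem_singleton]
    exact ⟨fun h => le_antisymm h.2.1 h.2.2, by rintro rfl; exact ⟨hx, le_rfl, le_rfl⟩⟩
  have e1 := split S s hs
  have e2 := split R r hr
  have e3 := split _ _ (mul_mem_mul hs hr)
  have := nS.card_pos
  have := nR.card_pos
  have := nS'.card_pos
  have := nR'.card_pos
  omega

/-- Both products have the same rank in `S * R`. -/
theorem mul_eq_mul_of_consecutive {S R : Finset G} (h : #(S * R) + 1 = #S + #R) {s s' r r' : G}
    (hs : s ∈ S) (hs' : s' ∈ S) (hss : s < s') (hsc : ∀ x ∈ S, s < x → s' ≤ x)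
    (hr : r ∈ R) (hr' : r' ∈ R) (hrr : r < r') (hrc : ∀ x ∈ R, r < x → r' ≤ x) :
    s' * r = s * r' := by
  have succ : ∀ (T : Finset G) (x y : G), y ∈ T → x < y → (∀ z ∈ T, x < z → y ≤ z) →
      #{z ∈ T | z ≤ y} = #{z ∈ T | z ≤ x} + 1 := by
    intro T x y hy hxy hc
    rw [← card_insert_of_notMem (a := y) (by simp [hxy])]
    congr 1
    ext z
    simp only [mem_filter, mem_insert]
    constructor
    · rintro ⟨hz, hzy⟩
      by_cases hzx : z ≤ x
      · exact Or.inr ⟨hz, hzx⟩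
      · exact Or.inl (hzy.antisymm (hc z hz (not_le.1 hzx)))
    · rintro (rfl | ⟨hz, hzx⟩)
      · exact ⟨hy, le_rfl⟩
      · exact ⟨hz, hzx.trans hxy.le⟩
  have mono : ∀ (T : Finset G) (x y : G), y ∈ T → x < y → #{z ∈ T | z ≤ x} < #{z ∈ T | z ≤ y} := by
    intro T x y hy hxy
    refine card_lt_card ⟨monotone_filter_right _ fun z _ hz => hz.trans hxy.le, fun hsub => ?_⟩
    have := hsub (mem_filter.2 ⟨hy, le_rfl⟩)
    exact (mem_filter.1 this).2.not_gt hxy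
  have e1 := card_filter_le_mul h hs' hr
  have e2 := card_filter_le_mul h hs hr'
  have e3 := succ S s s' hs' hss hsc
  have e4 := succ R r r' hr' hrr hrc
  rcases lt_trichotomy (s' * r) (s * r') with hlt | heq | hlt
  · have := mono _ _ _ (mul_mem_mul hs hr') hlt
    omega
  · exact heq
  · have := mono _ _ _ (mul_mem_mul hs' hr) hlt
    omega

/-- Equality case of the Cauchy–Davenport bound in an ordered group: the ratio is that of the two
smallest elements of `R`. -/
theorem exists_ratio_of_card_mul {S R : Finset G} (hS : 2 ≤ #S) (hR : 2 ≤ #R)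
    (h : #(S * R) + 1 = #S + #R) : ∃ d, IsStepClosed S d ∧ IsFirstStep (S * R) d := by
  have nS : S.Nonempty := card_pos.1 (by omega)
  have nR : R.Nonempty := card_pos.1 (by omega)
  obtain ⟨r₀, hr₀, hr₀min⟩ : ∃ r₀ ∈ R, ∀ x ∈ R, r₀ ≤ x :=
    ⟨R.min' nR, min'_mem _ _, fun x hx => min'_le _ _ hx⟩
  obtain ⟨s₀, hs₀, hs₀min⟩ : ∃ s₀ ∈ S, ∀ x ∈ S, s₀ ≤ x :=
    ⟨S.min' nS, min'_mem _ _, fun x hx => min'_le _ _ hx⟩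
  have succ : ∀ (T : Finset G) (x y : G), y ∈ T → x < y →
      ∃ z ∈ T, x < z ∧ ∀ w ∈ T, x < w → z ≤ w := by
    intro T x y hy hxy
    have ne : ({z ∈ T | x < z}).Nonempty := ⟨y, by simp [hy, hxy]⟩
    obtain ⟨h1, h2⟩ := mem_filter.1 (min'_mem _ ne)
    exact ⟨_, h1, h2, fun w hw hxw => min'_le _ _ (by simp [hw, hxw])⟩
  obtain ⟨r, hr, hne⟩ := exists_mem_ne (by omega : 1 < #R) r₀
  obtain ⟨r₁, hr₁, h01, hr₁min⟩ := succ R r₀ r hr (lt_of_le_of_ne (hr₀min r hr) hne.symm)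
  obtain ⟨d, rfl⟩ : ∃ d, r₁ = r₀ * d := ⟨r₀⁻¹ * r₁, by simp⟩
  have hd : 1 < d := by simpa using h01
  have hstep : IsStepClosed S d := by
    intro s hs t ht hst
    obtain ⟨s', hs', hss', hmin⟩ := succ S s t ht hst
    have := mul_eq_mul_of_consecutive h hs hs' hss' hmin hr₀ hr₁ h01 hr₁min
    have : s' = s * d := by
      rw [mul_left_comm, mul_comm] at this
      exact mul_left_cancel this
    rw [← this]
    exact ⟨hs', hmin t ht hst⟩
  refine ⟨d, hstep, hd, s₀ * r₀, mul_mem_mul hs₀ hr₀, ?_, ?_⟩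
  · rw [mul_assoc]; exact mul_mem_mul hs₀ hr₁
  · intro x hx
    obtain ⟨s, hs, r, hr, rfl⟩ := mem_mul.1 hx
    rcases (hs₀min s hs).eq_or_lt with rfl | hlt
    · rcases (hr₀min r hr).eq_or_lt with rfl | hlt
      · exact Or.inl rfl
      · rw [mul_assoc]
        exact Or.inr (mul_le_mul_right (hr₁min r hr hlt) _)
    · rw [mul_right_comm]
      exact Or.inr (mul_le_mul' (hstep _ hs₀ _ hs hlt).2 (hr₀min r hr))

end Order

/-! ### Products of several sets -/

section Products

variable {ι G : Type*} [DecidableEq ι] [DecidableEq G] [CommGroup G]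

theorem sum_card_le_card_prod [IsMulTorsionFree G] {s : Finset ι} {B : ι → Finset G}
    (hB : ∀ i ∈ s, (B i).Nonempty) :
    (∏ i ∈ s, B i).Nonempty ∧ ∑ i ∈ s, #(B i) + 1 ≤ #(∏ i ∈ s, B i) + #s := by
  induction s using Finset.induction_on with
  | empty => simp
  | insert i s hi ih =>
    obtain ⟨h1, h2⟩ := ih fun i hi => hB i (mem_insert_of_mem hi)
    have hBi := hB i (mem_insert_self _ _)
    rw [prod_insert hi, sum_insert hi, card_insert_of_notMem hi]
    have := cauchy_davenport_of_isMulTorsionFree hBi h1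
    exact ⟨hBi.mul h1, by omega⟩

end Products

/-- Each `B i` and the product of the remaining sets attain equality in the Cauchy–Davenport bound;
the ratio obtained does not depend on `i` since the full product set determines it. -/
theorem exists_ratio_of_card_prod {ι G : Type*} [DecidableEq ι] [CommGroup G] [LinearOrder G]
    [IsOrderedMonoid G] {s : Finset ι} {B : ι → Finset G} (hs : 2 ≤ #s)
    (hB : ∀ i ∈ s, 2 ≤ #(B i)) (h : #(∏ i ∈ s, B i) + #s ≤ ∑ i ∈ s, #(B i) + 1) :
    ∃ d, IsFirstStep (∏ i ∈ s, B i) d ∧ ∀ i ∈ s, IsStepClosed (B i) d := by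
  have key : ∀ i ∈ s, ∃ d, IsStepClosed (B i) d ∧ IsFirstStep (∏ i ∈ s, B i) d := by
    intro i hi
    have hne : ∀ i ∈ s, (B i).Nonempty := fun i hi => card_pos.1 (by have := hB i hi; omega)
    obtain ⟨h1, h2⟩ := sum_card_le_card_prod fun j hj => hne j (mem_of_mem_erase (a := i) hj)
    have h3 : ∑ j ∈ s.erase i, 2 ≤ ∑ j ∈ s.erase i, #(B j) :=
      sum_le_sum fun j hj => hB j (mem_of_mem_erase hj)
    rw [sum_const, smul_eq_mul] at h3
    rw [← mul_prod_erase s B hi, ← add_sum_erase s (fun j => #(B j)) hi] at h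
    have h4 := cauchy_davenport_of_isMulTorsionFree (hne i hi) h1
    have h5 := card_erase_of_mem hi
    have h6 := hB i hi
    rw [← mul_prod_erase s B hi]
    exact exists_ratio_of_card_mul h6 (by omega) (by omega)
  obtain ⟨i, hi⟩ : s.Nonempty := card_pos.1 (by omega)
  obtain ⟨d, -, hd⟩ := key i hi
  refine ⟨d, hd, fun j hj => ?_⟩
  obtain ⟨e, he, he'⟩ := key j hj
  rwa [hd.unique he']

/-! ### Comparison with commutative product sets -/

theorem genProd_eq_selProd {G : Type*} [CommGroup G] [DecidableEq G] {m : ℕ} (l : ℕ)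
    (A : Fin m → Finset G) : genProd l A = selProd l univ A := by
  ext x
  rw [mem_coe, mem_selProd]
  constructor
  · rintro ⟨i, hi, a, ha, rfl⟩
    refine ⟨univ.map ⟨i, hi⟩, subset_univ _, by simp, Function.extend i a 1, ?_, ?_⟩
    · intro k hk
      obtain ⟨j, -, rfl⟩ := mem_map.1 hk
      simpa [hi.extend_apply] using ha j
    · simp [hi.extend_apply, List.prod_ofFn]
  · rintro ⟨T, -, hT, f, hf, rfl⟩
    refine ⟨T.orderEmbOfFin hT, (T.orderEmbOfFin hT).injective, fun j => f (T.orderEmbOfFin hT j),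
      fun j => hf _ (T.orderEmbOfFin_mem hT j), ?_⟩
    rw [List.prod_ofFn]
    conv_rhs => rw [← T.map_orderEmbOfFin_univ hT, prod_map]
    rfl

theorem orderedProd_eq_prod {G : Type*} [CommGroup G] [DecidableEq G] {l : ℕ}
    (B : Fin l → Finset G) : orderedProd B = ((∏ i, B i : Finset G) : Set G) := by
  ext x
  rw [coe_prod, Set.mem_finsetProd]
  simp only [orderedProd, Set.mem_ofPred_eq, List.prod_ofFn, mem_univ, mem_coe, forall_true_left]
  exact ⟨fun ⟨b, h, e⟩ => ⟨b, fun {i} => h i, e⟩, fun ⟨b, h, e⟩ => ⟨b, fun i => h, e⟩⟩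

theorem mu_eq_min_deg {G : Type*} [DecidableEq G] {m : ℕ} (l : ℕ) (A : Fin m → Finset G) (a : G) :
    mu l A a = min l (deg univ A a) := by
  rw [mu, deg, card_filter]

/-! ### Minimizing sequences attain equality -/

theorem card_prod_le_of_isGeomProgOfType {ι G : Type*} [DecidableEq ι] [CommGroup G]
    [DecidableEq G] {s : Finset ι} {B : ι → Finset G} {g : G} {α β : ι → G}
    (h : ∀ i ∈ s, IsGeomProgOfType (B i) (α i) g (β i)) :
    #(∏ i ∈ s, B i) + #s ≤ ∑ i ∈ s, #(B i) + 1 := by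
  obtain ⟨n, c, hn, hc⟩ : ∃ (n : ℕ) (c : G), n + #s = ∑ i ∈ s, #(B i) + 1 ∧
      ∏ i ∈ s, B i ⊆ (range n).image fun k => c * g ^ k := by
    induction s using Finset.induction_on with
    | empty => exact ⟨1, 1, by simp, fun x hx => by simpa using hx⟩
    | insert i s hi ih =>
      obtain ⟨n, c, hn, hc⟩ := ih fun i hi => h i (mem_insert_of_mem hi)
      obtain ⟨hne, -, hB⟩ := h i (mem_insert_self _ _)
      have := hne.card_pos
      refine ⟨n + #(B i) - 1, α i * β i * c, ?_, ?_⟩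
      · rw [card_insert_of_notMem hi, sum_insert hi]
        omega
      · rw [prod_insert hi]
        intro x hx
        obtain ⟨y, hy, z, hz, rfl⟩ := mem_mul.1 hx
        rw [hB] at hy
        obtain ⟨p, hp, rfl⟩ := mem_image.1 hy
        obtain ⟨q, hq, rfl⟩ := mem_image.1 (hc hz)
        rw [mem_range] at hp hq
        refine mem_image.2 ⟨p + q, mem_range.2 (by omega), ?_⟩
        rw [pow_add]
        simp only [mul_assoc, mul_comm, mul_left_comm]
  have := (card_le_card hc).trans card_image_le
  rw [card_range] at this
  omega

theorem ncard_eq_of_isMinimizing {G : Type*} [CommGroup G] [IsMulTorsionFree G] [DecidableEq G]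
    {l m : ℕ} {A : Fin m → Finset G} {d : G} (h : IsMinimizing l d A) :
    (genProd l A).ncard + l = ∑ a ∈ unionSet A, mu l A a + 1 := by
  obtain ⟨-, B, hBA, hB, ⟨α, β, hαβ, -⟩, hmu, hprod⟩ := h
  have hsum : ∑ a ∈ unionSet A, mu l A a = ∑ j, #(B j) := by
    rw [sum_congr rfl hmu, sum_comm]
    refine sum_congr rfl fun j _ => ?_
    rw [← card_filter, filter_mem_eq_inter, inter_eq_right.2 (hBA j)]
  have h1 := card_prod_le_of_isGeomProgOfType fun j (_ : j ∈ univ) => hαβ j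
  obtain ⟨-, h2⟩ := sum_card_le_card_prod (s := univ) fun j _ => (hαβ j).1
  rw [← hprod, orderedProd_eq_prod, Set.ncard_coe_finset, hsum]
  rw [card_univ, Fintype.card_fin] at h1 h2
  omega

/-- In a commutative group the types of progressions with a common ratio can be chained: take for
`β i` the product of the first elements of the progressions up to index `i`. -/
theorem exists_isGeomProgOfType_chain {G : Type*} [CommGroup G] [DecidableEq G] {l : ℕ}
    {B : Fin l → Finset G} {g : G} (h : ∀ i, IsGeomProg (B i) g) :
    ∃ α β : Fin l → G, (∀ i, IsGeomProgOfType (B i) (α i) g (β i)) ∧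
      ∀ i j : Fin l, (j : ℕ) = i + 1 → α j = (β i)⁻¹ := by
  choose hne hg a ha using h
  refine ⟨fun i => (∏ k ∈ Iio i, a k)⁻¹, fun i => ∏ k ∈ Iic i, a k, fun i => ⟨hne i, hg i, ?_⟩,
    fun i j hij => ?_⟩
  · have : ∏ k ∈ Iic i, a k = a i * ∏ k ∈ Iio i, a k := by
      rw [← Iio_insert, prod_insert (by simp)]
    conv_lhs => rw [ha i]
    refine image_congr fun k _ => ?_
    simp only
    rw [this]
    generalize ∏ k ∈ Iio i, a k = p
    rw [mul_right_comm, mul_left_comm, inv_mul_cancel, mul_one]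
  · have : Iio j = Iic i := by
      ext k
      rw [mem_Iio, mem_Iic, Fin.lt_def, Fin.le_def]
      omega
    simp only [this]

/-! ### The structure forced by equality -/

section Extremal

variable {ι G : Type*} [DecidableEq ι] [CommGroup G] [LinearOrder G]

/-- Any two of the sets `A k`, `A j` lie in a common set `B k` of some reduction. -/
theorem isStepClosed_biUnion {l : ℕ} {s : Finset ι} {A : ι → Finset G} {d : G} (hl : 0 < l)
    (hs : l < #s) (h : ∀ s₀ ⊆ s, #s₀ = l → ∀ B, IsReduction l s A s₀ B →
      ∀ i ∈ s₀, IsStepClosed (B i) d) : IsStepClosed (s.biUnion A) d := by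
  intro x hx y hy hxy
  obtain ⟨k, hk, hx⟩ := mem_biUnion.1 hx
  obtain ⟨j, hj, hy⟩ := mem_biUnion.1 hy
  obtain ⟨s₀, hs₀, hl₀, hk₀, B, hB, hxB, hyB⟩ : ∃ s₀ ⊆ s, #s₀ = l ∧ k ∈ s₀ ∧
      ∃ B, IsReduction l s A s₀ B ∧ x ∈ B k ∧ y ∈ B k := by
    rcases eq_or_ne k j with rfl | hkj
    · obtain ⟨s₀, hks, hs₀, rfl⟩ := exists_subsuperset_card_eq (singleton_subset_iff.2 hk)
        (by rwa [card_singleton]) hs.le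
      obtain ⟨B, hB, -⟩ := exists_isReduction (singleton_subset_iff.1 hks) hs₀ A
      have := hB.subset k (singleton_subset_iff.1 hks)
      exact ⟨s₀, hs₀, rfl, singleton_subset_iff.1 hks, B, hB, this hx, this hy⟩
    · have hk' : k ∈ s.erase j := mem_erase.2 ⟨hkj, hk⟩
      obtain ⟨s₀, hks, hs₀, rfl⟩ := exists_subsuperset_card_eq (singleton_subset_iff.2 hk')
        (by rwa [card_singleton]) (by rw [card_erase_of_mem hj]; omega : l ≤ #(s.erase j))
      rw [subset_erase] at hs₀
      obtain ⟨B, hB, hB'⟩ :=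
        exists_isReduction_union hs₀.1 (singleton_subset_iff.1 hks) hj hs₀.2 A
      exact ⟨s₀, hs₀.1, rfl, singleton_subset_iff.1 hks, B, hB, hB' (mem_union_left _ hx),
        hB' (mem_union_right _ hy)⟩
  obtain ⟨h1, h2⟩ := h s₀ hs₀ hl₀ B hB k hk₀ x hxB y hyB hxy
  exact ⟨mem_biUnion.2 ((hB.mem_iff hl _).1 ⟨k, hk₀, h1⟩), h2⟩

/-- The set at `i` of a suitable reduction is exactly `A i` together with the elements of full
multiplicity. -/
theorem isStepClosed_union_filter {l : ℕ} {s : Finset ι} {A : ι → Finset G} {d : G} (hl : 0 < l)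
    (hs : l < #s) (h : ∀ s₀ ⊆ s, #s₀ = l → ∀ B, IsReduction l s A s₀ B →
      ∀ i ∈ s₀, IsStepClosed (B i) d) {i : ι} (hi : i ∈ s) :
    IsStepClosed (A i ∪ {a ∈ s.biUnion A | min l (deg s A a) = l}) d := by
  obtain ⟨s₀, his, hs₀, rfl⟩ := exists_subsuperset_card_eq (singleton_subset_iff.2 hi)
    (by rwa [card_singleton]) hs.le
  rw [singleton_subset_iff] at his
  obtain ⟨B, hB, hB'⟩ := exists_isReduction his hs₀ A
  convert h s₀ hs₀ rfl B hB i his using 1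
  ext a
  rw [mem_union, mem_filter]
  constructor
  · rintro (ha | ⟨-, ha⟩)
    · exact hB.subset i his ha
    · rw [← hB.deg_eq, deg, card_filter_eq_iff] at ha
      exact ha i his
  · intro ha
    by_cases hai : a ∈ A i
    · exact Or.inl hai
    · exact Or.inr ⟨mem_biUnion.2 ((hB.mem_iff hl a).1 ⟨i, his, ha⟩), min_eq_left (hB' a ha hai)⟩

variable [IsOrderedMonoid G]

theorem IsReduction.exists_ratio {s s₀ : Finset ι} {A B : ι → Finset G}
    (h : IsReduction #s₀ s A s₀ B) (hs₀ : 2 ≤ #s₀) (hA : ∀ i ∈ s₀, 2 ≤ #(A i))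
    (heq : #(selProd #s₀ s A) + #s₀ ≤ ∑ a ∈ s.biUnion A, min #s₀ (deg s A a) + 1) :
    ∏ i ∈ s₀, B i = selProd #s₀ s A ∧
      ∃ d, IsFirstStep (selProd #s₀ s A) d ∧ ∀ i ∈ s₀, IsStepClosed (B i) d := by
  have hB : ∀ i ∈ s₀, 2 ≤ #(B i) := fun i hi => (hA i hi).trans (card_le_card (h.subset i hi))
  rw [← h.sum_card (by omega)] at heq
  obtain ⟨-, h1⟩ := sum_card_le_card_prod fun i hi =>
    card_pos.1 (lt_of_lt_of_le two_pos (hB i hi))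
  have hprod : ∏ i ∈ s₀, B i = selProd #s₀ s A := eq_of_subset_of_card_le h.prod_subset (by omega)
  refine ⟨hprod, ?_⟩
  rw [← hprod] at heq ⊢
  exact exists_ratio_of_card_prod hs₀ hB heq

/-- If the product set has the least possible size, then all reductions consist of progressions with
one and the same ratio, since it is the ratio of the two smallest elements of `selProd l s A`. -/
theorem exists_common_ratio {l : ℕ} {s : Finset ι} {A : ι → Finset G} (hl : 2 ≤ l) (hs : l < #s)
    (hA : ∀ i ∈ s, 2 ≤ #(A i))
    (heq : #(selProd l s A) + l ≤ ∑ a ∈ s.biUnion A, min l (deg s A a) + 1) :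
    ∃ d, 1 < d ∧ ∀ s₀ ⊆ s, #s₀ = l → ∀ B, IsReduction l s A s₀ B →
      ∏ i ∈ s₀, B i = selProd l s A ∧ ∀ i ∈ s₀, IsStepClosed (B i) d := by
  have key : ∀ s₀ ⊆ s, #s₀ = l → ∀ B, IsReduction l s A s₀ B →
      ∏ i ∈ s₀, B i = selProd l s A ∧
        ∃ d, IsFirstStep (selProd l s A) d ∧ ∀ i ∈ s₀, IsStepClosed (B i) d := by
    rintro s₀ hs₀ rfl B hB
    exact hB.exists_ratio hl (fun i hi => hA i (hs₀ hi)) heq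
  obtain ⟨t, ht, htl⟩ := exists_subset_card_eq hs.le
  obtain ⟨i, hi⟩ : t.Nonempty := card_pos.1 (by omega)
  obtain ⟨B, hB, -⟩ := exists_isReduction hi ht A
  obtain ⟨-, d, hd, -⟩ := key t ht htl B (htl ▸ hB)
  refine ⟨d, hd.1, fun s₀ hs₀ hl₀ B hB => ?_⟩
  obtain ⟨h1, e, he, h2⟩ := key s₀ hs₀ hl₀ B hB
  exact ⟨h1, hd.unique he ▸ h2⟩

theorem isMinimizing_and_isGeomProg {l m : ℕ} (hl : 2 ≤ l) (hlm : l < m) (A : Fin m → Finset G)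
    (hA : ∀ i, 2 ≤ #(A i)) (heq : (genProd l A).ncard + l = ∑ a ∈ unionSet A, mu l A a + 1) :
    ∃ d : G, IsMinimizing l d A ∧ d ≠ 1 ∧ (∀ i, IsGeomProg (A i ∪ fullSet l A) d) ∧
      IsGeomProg (unionSet A) d := by
  have hm : l < #(univ : Finset (Fin m)) := by simpa using hlm
  have hne : ∀ i, (A i).Nonempty := fun i => card_pos.1 (lt_of_lt_of_le two_pos (hA i))
  rw [genProd_eq_selProd, Set.ncard_coe_finset] at heq
  simp only [mu_eq_min_deg] at heq
  obtain ⟨d, hd, h⟩ := exists_common_ratio hl hm (fun i _ => hA i) heq.le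
  have h' := fun s₀ hs₀ hl₀ B hB => (h s₀ hs₀ hl₀ B hB).2
  refine ⟨d, ⟨hd.ne', ?_⟩, hd.ne', fun i => ?_, ?_⟩
  · set s₀ : Finset (Fin m) := univ.map (Fin.castLEEmb hlm.le) with hs₀
    have hl₀ : #s₀ = l := by simp [s₀]
    have h0 : Fin.castLEEmb hlm.le ⟨0, by omega⟩ ∈ s₀ := mem_map_of_mem _ (mem_univ _)
    obtain ⟨B, hB, -⟩ := exists_isReduction h0 (subset_univ _) A
    rw [hl₀] at hB
    obtain ⟨h1, h2⟩ := h s₀ (subset_univ _) hl₀ B hB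
    have hmem : ∀ j, Fin.castLEEmb hlm.le j ∈ s₀ := fun j => mem_map_of_mem _ (mem_univ _)
    refine ⟨fun j => B (Fin.castLEEmb hlm.le j), fun j a ha => ?_, fun j => ?_,
      exists_isGeomProgOfType_chain fun j => ?_, fun a _ => ?_, ?_⟩
    · exact mem_biUnion.2 ((hB.mem_iff (by omega) a).1 ⟨_, hmem j, ha⟩)
    · exact (hA _).trans (card_le_card (hB.subset _ (hmem j)))
    · exact (h2 _ (hmem j)).isGeomProg ((hne _).mono (hB.subset _ (hmem j))) hd
    · rw [mu_eq_min_deg, ← hB.deg_eq, deg, card_filter, hs₀, sum_map]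
    · rw [orderedProd_eq_prod, genProd_eq_selProd, ← h1, hs₀, prod_map]
  · refine IsStepClosed.isGeomProg ((hne i).mono subset_union_left) hd ?_
    simp only [fullSet, mu_eq_min_deg]
    exact isStepClosed_union_filter (by omega) hm h' (mem_univ i)
  · refine (isStepClosed_biUnion (by omega) hm h').isGeomProg ?_ hd
    exact (hne ⟨0, by omega⟩).mono (subset_biUnion_of_mem A (mem_univ _))

end Extremal

end GenProductSet

theorem corollary1p11 {G : Type*} [CommGroup G] [IsMulTorsionFree G] [DecidableEq G]
    (l m : ℕ) (hl : 2 ≤ l) (hlm : l < m) (A : Fin m → Finset G) (hA : ∀ i, 2 ≤ (A i).card) :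
    (((GenProductSet.genProd l A).ncard : ℤ) =
        (∑ a ∈ GenProductSet.unionSet A, (GenProductSet.mu l A a : ℤ)) - l + 1 ↔
      ∃ d : G, GenProductSet.IsMinimizing l d A) ∧
    (((GenProductSet.genProd l A).ncard : ℤ) =
        (∑ a ∈ GenProductSet.unionSet A, (GenProductSet.mu l A a : ℤ)) - l + 1 →
      ∃ g : G, g ≠ 1 ∧
        (∀ i, GenProductSet.IsGeomProg (A i ∪ GenProductSet.fullSet l A) g) ∧
        GenProductSet.IsGeomProg (GenProductSet.unionSet A) g) := by
  rw [← Nat.cast_sum]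
  have hcast : ((GenProductSet.genProd l A).ncard : ℤ) =
      ((∑ a ∈ GenProductSet.unionSet A, GenProductSet.mu l A a : ℕ) : ℤ) - l + 1 ↔
      (GenProductSet.genProd l A).ncard + l =
        ∑ a ∈ GenProductSet.unionSet A, GenProductSet.mu l A a + 1 := by omega
  rw [hcast]
  have key : (GenProductSet.genProd l A).ncard + l =
      ∑ a ∈ GenProductSet.unionSet A, GenProductSet.mu l A a + 1 →
      ∃ d : G, GenProductSet.IsMinimizing l d A ∧ d ≠ 1 ∧
        (∀ i, GenProductSet.IsGeomProg (A i ∪ GenProductSet.fullSet l A) d) ∧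
        GenProductSet.IsGeomProg (GenProductSet.unionSet A) d := by
    obtain ⟨_, _⟩ := GenProductSet.exists_linearOrder_isOrderedMonoid G
    -- The order brings its own decidable equality, which is identified with the given one.
    obtain rfl : ‹DecidableEq G› = LinearOrder.toDecidableEq := Subsingleton.elim _ _
    exact GenProductSet.isMinimizing_and_isGeomProg hl hlm A hA
  refine ⟨⟨fun h => ?_, fun ⟨d, hd⟩ => GenProductSet.ncard_eq_of_isMinimizing hd⟩, fun h => ?_⟩
  · obtain ⟨d, hd, -⟩ := key h
    exact ⟨d, hd⟩
  · obtain ⟨d, -, hd⟩ := key h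
    exact ⟨d, hd⟩
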